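/- Identify a finite sequence $(f_0,\dots,f_{k-1})$ of complex numbers with the polynomial $f(z)=\sum_j f_j z^j$, where $f_j=0$ for every integer $j\notin\{0,\dots,k-1\}$. For $s\in\mathbb Z$ let $C_{f,f}(s)=\sum_{j\in\mathbb Z} f_{j+s}\overline{f_j}$ be the aperiodic autocorrelation of $f$ at shift $s$, and let $\mathrm{PSL}(f)=\max_{s\in\mathbb Z\setminus\{0\}}|C_{f,f}(s)|$ be its peak sidelobe level. The Rudin–Shapiro sequences $x_n$ and their companions $y_n$ are defined by $x_0=y_0=1$ and $$x_{n+1}(z)=x_n(z)+z^{2^n}y_n(z),\qquad y_{n+1}(z)=x_n(z)-z^{2^n}y_n(z)\qquad(n\ge 0).$$ **Theorem.** The polynomial $X^3+X^2-2X-4$ has exactly one real root $\alpha_0=1.658967\ldots$. For every integer $n\ge 0$ we have $\mathrm{PSL}(x_n)=\mathrm{PSL}(y_n)$ and the upper bound $$\mathrm{PSL}(x_n)\le 5\,\alpha_0^{\,n-4}=(0.660113\ldots)\,\alpha_0^{\,n},$$ with equality if $n=4$ and strict inequality for all other $n$. Moreover, for every integer $n\ge 0$, $$\mathrm{PSL}(x_n)\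 \ge\ \left[\frac{3\alpha_0^2+21\alpha_0+2}{118}-\sqrt{\frac{6\alpha_0^2+6\alpha_0-16}{59}}\left(\sqrt{\frac{\alpha_0^2-1}{2}}\right)^{n}\right]\alpha_0^{\,n},$$ where $\frac{3\alpha_0^2+21\alpha_0+2}{118}=0.382159\ldots$, $\sqrt{\frac{6\alpha_0^2+6\alpha_0-16}{59}}=0.421193\ldots$ and $\sqrt{\frac{\alpha_0^2-1}{2}}=0.935994\ldots$. -/

import Mathlib

open Polynomial

noncomputable section

/-- The `j`-th term `f_j` of the sequence identified with the polynomial `f`, indexed by all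
integers `j`, with `f_j = 0` for negative `j` (and for `j` beyond the degree). -/
def seqTerm (f : ℂ[X]) (j : ℤ) : ℂ :=
  if 0 ≤ j then f.coeff j.toNat else 0

/-- The aperiodic crosscorrelation `C_{f,g}(s) = ∑_{j ∈ ℤ} f_{j+s} * conj (g_j)` (a sum with
finitely many nonzero terms, see `finite_support_crossCorr`). -/
def crossCorr (f g : ℂ[X]) (s : ℤ) : ℂ :=
  ∑ᶠ j : ℤ, seqTerm f (j + s) * (starRingEnd ℂ) (seqTerm g j)

/-- The peak sidelobe level `PSL(f)`: the maximum of `|C_{f,f}(s)|` over all nonzero integers `s`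
(the supremum is attained, see `isGreatest_PSL`). -/
def PSL (f : ℂ[X]) : ℝ :=
  sSup {r : ℝ | ∃ s : ℤ, s ≠ 0 ∧ r = ‖crossCorr f f s‖}

/-- The Golay--Rudin--Shapiro recursion with initial length `l` and seed pair `(x, y)`:
`x_{n+1} = x_n + z ^ (2 ^ n * l) * y_n` and `y_{n+1} = x_n - z ^ (2 ^ n * l) * y_n`. -/
def golayRudinShapiro (l : ℕ) (x y : ℂ[X]) : ℕ → ℂ[X] × ℂ[X]
  | 0 => (x, y)
  | n + 1 =>
    let p := golayRudinShapiro l x y n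
    (p.1 + X ^ (2 ^ n * l) * p.2, p.1 - X ^ (2 ^ n * l) * p.2)

/-- The `n`-th Rudin--Shapiro sequence `x_n`. -/
def rsSeq (n : ℕ) : ℂ[X] := (golayRudinShapiro 1 1 1 n).1

/-- The `n`-th Rudin--Shapiro companion sequence `y_n`. -/
def rsCompanion (n : ℕ) : ℂ[X] := (golayRudinShapiro 1 1 1 n).2

theorem seqTerm_eq_zero {f : ℂ[X]} {j : ℤ} (h : j < 0 ∨ (f.natDegree : ℤ) < j) :
    seqTerm f j = 0 := by
  unfold seqTerm
  split_ifs with h0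
  · exact coeff_eq_zero_of_natDegree_lt (by omega)
  · rfl

theorem finite_support_crossCorr (f g : ℂ[X]) (s : ℤ) :
    (Function.support fun j : ℤ => seqTerm f (j + s) * (starRingEnd ℂ) (seqTerm g j)).Finite := by
  refine (Set.finite_Icc (0 : ℤ) g.natDegree).subset fun j hj => ?_
  by_contra hn
  refine hj ?_
  have : seqTerm g j = 0 := seqTerm_eq_zero (by simp only [Set.mem_Icc] at hn; omega)
  simp [this]

theorem crossCorr_eq_zero {f g : ℂ[X]} {s : ℤ}
    (h : s < -(g.natDegree : ℤ) ∨ (f.natDegree : ℤ) < s) : crossCorr f g s = 0 := by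
  unfold crossCorr
  refine finsum_eq_zero_of_forall_eq_zero fun j => ?_
  by_cases hj : j < 0 ∨ (g.natDegree : ℤ) < j
  · simp [seqTerm_eq_zero hj]
  · have : seqTerm f (j + s) = 0 := seqTerm_eq_zero (by omega)
    simp [this]

/-- The peak sidelobe level is a genuine maximum. -/
theorem isGreatest_PSL (f : ℂ[X]) :
    IsGreatest {r : ℝ | ∃ s : ℤ, s ≠ 0 ∧ r = ‖crossCorr f f s‖} (PSL f) := by
  have hfin : {r : ℝ | ∃ s : ℤ, s ≠ 0 ∧ r = ‖crossCorr f f s‖}.Finite := by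
    refine (((Set.finite_Icc (-(f.natDegree : ℤ)) f.natDegree).image
      fun s => ‖crossCorr f f s‖).insert 0).subset ?_
    rintro r ⟨s, -, rfl⟩
    by_cases hs : s ∈ Set.Icc (-(f.natDegree : ℤ)) f.natDegree
    · exact Or.inr ⟨s, hs, rfl⟩
    · left
      rw [crossCorr_eq_zero (by simp only [Set.mem_Icc] at hs; omega), norm_zero]
  have hne : {r : ℝ | ∃ s : ℤ, s ≠ 0 ∧ r = ‖crossCorr f f s‖}.Nonempty :=
    ⟨_, 1, one_ne_zero, rfl⟩
  exact ⟨hne.csSup_mem hfin, fun r hr => le_csSup hfin.bddAbove hr⟩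

end

open Polynomial

/-! Sidelobes of `x_{n+1}` are values of the crosscorrelation of `x_n` and `y_n`
(`norm_crossCorr_rsSeq`), and these crosscorrelations satisfy a closed recursion. Its values at `s`,
`-s`, `2 ^ n - s` form a vector on which passing to the next level acts by one of two fixed linear
maps, `keepMap` or `reflectMap`; so every value is, up to sign, a coordinate of a product of these
maps applied to `(1, -1, 1)` or `0`. Upper bound: `reflectMap` has eigenvalue `-α₀`, and a polytope
norm is exhibited that both maps expand by at most `α₀` (`InPolytope.keep`, `InPolytope.reflect`).
The polytope lies strictly inside the cube, so a finite check at one level gives strict inequality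
from `n = 8` on; smaller `n` are computed. Lower bound: iterating `reflectMap` alone gives a linear
recurrence with characteristic polynomial `X ^ 3 + X ^ 2 - 2 * X - 4`, whose two complex roots
contribute only the error term (`rsPeak_cubic`). -/

/-! ### Sesquilinearity and shift rules for correlations. -/

theorem seqTerm_add (f g : ℂ[X]) (j : ℤ) : seqTerm (f + g) j = seqTerm f j + seqTerm g j := by
  unfold seqTerm; split_ifs <;> simp

theorem seqTerm_sub (f g : ℂ[X]) (j : ℤ) : seqTerm (f - g) j = seqTerm f j - seqTerm g j := by
  unfold seqTerm; split_ifs <;> simp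

theorem seqTerm_X_pow_mul (k : ℕ) (f : ℂ[X]) (j : ℤ) :
    seqTerm (X ^ k * f) j = seqTerm f (j - k) := by
  unfold seqTerm
  rw [coeff_X_pow_mul']
  by_cases h0 : 0 ≤ j
  · by_cases h1 : (k : ℤ) ≤ j
    · rw [if_pos h0, if_pos (by omega), if_pos (by omega)]
      congr 1
      omega
    · rw [if_pos h0, if_neg (by omega), if_neg (by omega)]
  · rw [if_neg h0, if_neg (by omega)]

theorem crossCorr_add_left (f g h : ℂ[X]) (s : ℤ) :
    crossCorr (f + g) h s = crossCorr f h s + crossCorr g h s := by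
  unfold crossCorr
  rw [← finsum_add_distrib (finite_support_crossCorr f h s) (finite_support_crossCorr g h s)]
  exact finsum_congr fun j => by rw [seqTerm_add, add_mul]

theorem crossCorr_sub_left (f g h : ℂ[X]) (s : ℤ) :
    crossCorr (f - g) h s = crossCorr f h s - crossCorr g h s := by
  unfold crossCorr
  rw [← finsum_sub_distrib (finite_support_crossCorr f h s) (finite_support_crossCorr g h s)]
  exact finsum_congr fun j => by rw [seqTerm_sub, sub_mul]

theorem crossCorr_add_right (f g h : ℂ[X]) (s : ℤ) :
    crossCorr f (g + h) s = crossCorr f g s + crossCorr f h s := by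
  unfold crossCorr
  rw [← finsum_add_distrib (finite_support_crossCorr f g s) (finite_support_crossCorr f h s)]
  exact finsum_congr fun j => by rw [seqTerm_add, map_add, mul_add]

theorem crossCorr_sub_right (f g h : ℂ[X]) (s : ℤ) :
    crossCorr f (g - h) s = crossCorr f g s - crossCorr f h s := by
  unfold crossCorr
  rw [← finsum_sub_distrib (finite_support_crossCorr f g s) (finite_support_crossCorr f h s)]
  exact finsum_congr fun j => by rw [seqTerm_sub, map_sub, mul_sub]

theorem crossCorr_X_pow_mul_left (k : ℕ) (f g : ℂ[X]) (s : ℤ) :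
    crossCorr (X ^ k * f) g s = crossCorr f g (s - k) := by
  unfold crossCorr
  exact finsum_congr fun j => by rw [seqTerm_X_pow_mul, add_sub_assoc]

theorem crossCorr_X_pow_mul_right (k : ℕ) (f g : ℂ[X]) (s : ℤ) :
    crossCorr f (X ^ k * g) s = crossCorr f g (s + k) := by
  unfold crossCorr
  rw [← finsum_comp_equiv (Equiv.addRight (k : ℤ))]
  refine finsum_congr fun j => ?_
  rw [seqTerm_X_pow_mul, Equiv.coe_addRight, add_sub_cancel_right, add_right_comm, add_assoc]

theorem crossCorr_swap (f g : ℂ[X]) (s : ℤ) :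
    crossCorr g f s = (starRingEnd ℂ) (crossCorr f g (-s)) := by
  unfold crossCorr
  rw [← finsum_comp_equiv (Equiv.addRight (-s)),
    map_finsum (starRingEnd ℂ) (finite_support_crossCorr f g _)]
  refine finsum_congr fun j => ?_
  rw [map_mul, Complex.conj_conj, Equiv.coe_addRight, neg_add_cancel_right, mul_comm]

theorem crossCorr_one_one (s : ℤ) : crossCorr 1 1 s = if s = 0 then 1 else 0 := by
  have h (j : ℤ) : seqTerm 1 j = if j = 0 then 1 else 0 := by
    unfold seqTerm
    rw [coeff_one]
    split_ifs <;> first | rfl | omega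
  unfold crossCorr
  rw [finsum_eq_single _ 0 fun j hj => by simp [h, hj]]
  simp [h]

/-! ### Integer recursion for the Rudin–Shapiro correlations. -/

/-- The triple `(C_{x,x}, C_{y,y}, C_{x,y})` of integer-valued correlations of the `n`-th
Rudin--Shapiro pair `(x, y)`, given by the recursion that these correlations satisfy. -/
def rsCorr : ℕ → (ℤ → ℤ) × (ℤ → ℤ) × (ℤ → ℤ)
  | 0 => (fun s => if s = 0 then 1 else 0, fun s => if s = 0 then 1 else 0,
      fun s => if s = 0 then 1 else 0)
  | n + 1 =>
    let c := rsCorr n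
    (fun s => c.1 s + c.2.1 s + c.2.2 (2 ^ n - s) + c.2.2 (s + 2 ^ n),
      fun s => c.1 s + c.2.1 s - c.2.2 (2 ^ n - s) - c.2.2 (s + 2 ^ n),
      fun s => c.1 s - c.2.1 s + c.2.2 (2 ^ n - s) - c.2.2 (s + 2 ^ n))

theorem rsSeq_succ (n : ℕ) : rsSeq (n + 1) = rsSeq n + X ^ 2 ^ n * rsCompanion n := by
  simp [rsSeq, rsCompanion, golayRudinShapiro]

theorem rsCompanion_succ (n : ℕ) :
    rsCompanion (n + 1) = rsSeq n - X ^ 2 ^ n * rsCompanion n := by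
  simp [rsSeq, rsCompanion, golayRudinShapiro]

theorem crossCorr_rs (n : ℕ) (s : ℤ) :
    crossCorr (rsSeq n) (rsSeq n) s = (rsCorr n).1 s ∧
      crossCorr (rsCompanion n) (rsCompanion n) s = (rsCorr n).2.1 s ∧
      crossCorr (rsSeq n) (rsCompanion n) s = (rsCorr n).2.2 s := by
  induction n generalizing s with
  | zero => simp [rsSeq, rsCompanion, golayRudinShapiro, crossCorr_one_one, rsCorr]
  | succ n ih =>
    have hyx (t : ℤ) : crossCorr (rsCompanion n) (rsSeq n) t = (rsCorr n).2.2 (-t) := by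
      rw [crossCorr_swap, (ih _).2.2, map_intCast]
    have e : ((2 ^ n : ℕ) : ℤ) = 2 ^ n := by push_cast; rfl
    simp only [rsSeq_succ, rsCompanion_succ, crossCorr_add_left, crossCorr_add_right,
      crossCorr_sub_left, crossCorr_sub_right, crossCorr_X_pow_mul_left,
      crossCorr_X_pow_mul_right, hyx, (ih _).1, (ih _).2.1, (ih _).2.2, e, rsCorr, neg_sub,
      add_sub_cancel_right]
    push_cast
    refine ⟨by ring, by ring, by ring⟩

/-- The crosscorrelation of the `n`-th Rudin--Shapiro pair. -/
abbrev rsCross (n : ℕ) (s : ℤ) : ℤ := (rsCorr n).2.2 s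

theorem rsCorr_support (n : ℕ) {s : ℤ} (hs : 2 ^ n ≤ |s|) :
    (rsCorr n).1 s = 0 ∧ (rsCorr n).2.1 s = 0 ∧ rsCross n s = 0 := by
  induction n generalizing s with
  | zero =>
    have : s ≠ 0 := by rintro rfl; simp at hs
    simp [rsCorr, rsCross, this]
  | succ n ih =>
    rw [pow_succ, le_abs] at hs
    have hp : (0 : ℤ) < 2 ^ n := by positivity
    have h1 := ih (s := s) (by rw [le_abs]; omega)
    have h2 := ih (s := 2 ^ n - s) (by rw [le_abs]; omega)
    have h3 := ih (s := s + 2 ^ n) (by rw [le_abs]; omega)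
    simp only [rsCross] at h1 h2 h3 ⊢
    simp [rsCorr, h1, h2, h3]

theorem rsCross_eq_zero (n : ℕ) {s : ℤ} (hs : 2 ^ n ≤ s ∨ s ≤ -2 ^ n) : rsCross n s = 0 :=
  (rsCorr_support n (by rw [le_abs]; omega)).2.2

theorem rsCorr_complementary (n : ℕ) {s : ℤ} (hs : s ≠ 0) :
    (rsCorr n).2.1 s = -(rsCorr n).1 s := by
  induction n with
  | zero => simp [rsCorr, hs]
  | succ n ih => simp only [rsCorr, ih]; ring

theorem rsCorr_auto_succ (n : ℕ) {s : ℤ} (hs : s ≠ 0) :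
    (rsCorr (n + 1)).1 s = rsCross n (2 ^ n - s) + rsCross n (2 ^ n + s) := by
  simp only [rsCorr, rsCorr_complementary n hs, rsCross, add_comm s]; ring

theorem rsCorr_auto_neg (n : ℕ) {s : ℤ} (hs : s ≠ 0) :
    (rsCorr n).1 (-s) = (rsCorr n).1 s := by
  cases n with
  | zero => simp [rsCorr]
  | succ n =>
    rw [rsCorr_auto_succ n hs, rsCorr_auto_succ n (neg_ne_zero.2 hs), sub_neg_eq_add,
      ← sub_eq_add_neg, add_comm]

theorem rsCorr_auto_succ_of_pos (n : ℕ) {s : ℤ} (hs : 0 < s) :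
    (rsCorr (n + 1)).1 s = rsCross n (2 ^ n - s) := by
  rw [rsCorr_auto_succ n hs.ne', rsCross_eq_zero n (s := 2 ^ n + s) (by omega), add_zero]

theorem rsCross_zero_right (n : ℕ) : rsCross (n + 1) 0 = 0 := by
  have h : (rsCorr n).1 0 = (rsCorr n).2.1 0 := by
    cases n with
    | zero => rfl
    | succ n =>
      have := rsCross_eq_zero n (s := 2 ^ n) (by omega)
      simp only [rsCross] at this
      simp [rsCorr, this]
  simp [rsCross, rsCorr, h]

/-- This eliminates the autocorrelations, leaving a recursion in the crosscorrelation alone. -/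
theorem two_mul_rsCorr_auto (n : ℕ) {s : ℤ} (hs : 0 < s) :
    2 * (rsCorr n).1 s = rsCross n s - rsCross n (-s) := by
  cases n with
  | zero => simp [rsCorr, rsCross, hs.ne']
  | succ n =>
    rw [rsCorr_auto_succ_of_pos n hs]
    have h1 := rsCross_eq_zero n (s := s + 2 ^ n) (by omega)
    have h2 := rsCross_eq_zero n (s := 2 ^ n + s) (by omega)
    have h3 := rsCorr_auto_neg n hs.ne'
    have h4 := rsCorr_complementary n hs.ne'
    have h5 := rsCorr_complementary n (neg_ne_zero.2 hs.ne')
    have h6 : -s + 2 ^ n = 2 ^ n - s := by ring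
    simp only [rsCross] at h1 h2 ⊢
    simp only [rsCorr, h1, sub_neg_eq_add, h2, h5, h3, h4, h6]
    ring

theorem rsCross_succ_of_pos (n : ℕ) {s : ℤ} (hs : 0 < s) :
    rsCross (n + 1) s = rsCross n s - rsCross n (-s) + rsCross n (2 ^ n - s) := by
  rw [← two_mul_rsCorr_auto n hs]
  have h1 := rsCross_eq_zero n (s := s + 2 ^ n) (by omega)
  have h4 := rsCorr_complementary n hs.ne'
  simp only [rsCross] at h1 ⊢
  simp only [rsCorr, h1, h4]
  ring

theorem rsCross_succ_neg_of_pos (n : ℕ) {s : ℤ} (hs : 0 < s) :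
    rsCross (n + 1) (-s) = rsCross n s - rsCross n (-s) - rsCross n (2 ^ n - s) := by
  rw [← two_mul_rsCorr_auto n hs]
  have h1 := rsCross_eq_zero n (s := 2 ^ n + s) (by omega)
  have h3 := rsCorr_auto_neg n hs.ne'
  have h5 := rsCorr_complementary n (neg_ne_zero.2 hs.ne')
  have h6 : -s + 2 ^ n = 2 ^ n - s := by ring
  simp only [rsCross] at h1 ⊢
  simp only [rsCorr, sub_neg_eq_add, h1, h5, h3, h6]
  ring

/-! ### State vectors and the two linear maps. -/

/-- The values of the `n`-th Rudin--Shapiro crosscorrelation at `s`, `-s` and `2 ^ n - s`. -/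
def rsState (n : ℕ) (s : ℤ) : ℤ × ℤ × ℤ := (rsCross n s, rsCross n (-s), rsCross n (2 ^ n - s))

/-- The effect on `rsState` of passing from `(n, s)` to `(n + 1, s)`. -/
def keepMap (v : ℤ × ℤ × ℤ) : ℤ × ℤ × ℤ :=
  (v.1 - v.2.1 + v.2.2, v.1 - v.2.1 - v.2.2, -v.2.2)

/-- The effect on `rsState` of passing from `(n, s)` to `(n + 1, 2 ^ n - s)`. -/
def reflectMap (v : ℤ × ℤ × ℤ) : ℤ × ℤ × ℤ := (v.1 + 2 * v.2.2, 2 * v.2.2 - v.1, v.2.1)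

/-- At `±(2 ^ (n + 1) - s)` the unreflected level-`n` terms vanish, and the reflected term enters
with opposite signs. This oddness is why three values, not four, make a state. -/
theorem rsCross_sub_two_pow (n : ℕ) {s : ℤ} (h0 : 0 < s) (hs : s ≤ 2 ^ n) :
    rsCross (n + 1) (s - 2 ^ (n + 1)) = -rsCross (n + 1) (2 ^ (n + 1) - s) := by
  have hp : (2 : ℤ) ^ (n + 1) = 2 ^ n + 2 ^ n := by ring
  have h1 := rsCross_succ_of_pos n (s := 2 ^ (n + 1) - s) (by omega)
  have h2 := rsCross_succ_neg_of_pos n (s := 2 ^ (n + 1) - s) (by omega)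
  have h3 := rsCross_eq_zero n (s := 2 ^ (n + 1) - s) (by omega)
  have h4 := rsCross_eq_zero n (s := -(2 ^ (n + 1) - s)) (by omega)
  rw [neg_sub] at h2 h4
  rw [neg_sub] at h1
  rw [h1, h2, h3, h4]
  ring

theorem rsState_keep (n : ℕ) {s : ℤ} (h0 : 0 < s) (hs : s ≤ 2 ^ n) :
    rsState (n + 2) s = keepMap (rsState (n + 1) s) := by
  have hp : (2 : ℤ) ^ (n + 1) = 2 ^ n + 2 ^ n := by ring
  have hq : (2 : ℤ) ^ (n + 2) = 2 ^ (n + 1) + 2 ^ (n + 1) := by ring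
  have h1 := rsCross_succ_of_pos (n + 1) (s := 2 ^ (n + 2) - s) (by omega)
  have h3 := rsCross_eq_zero (n + 1) (s := 2 ^ (n + 2) - s) (by omega)
  have h4 := rsCross_eq_zero (n + 1) (s := -(2 ^ (n + 2) - s)) (by omega)
  have h5 := rsCross_sub_two_pow n h0 hs
  have h6 : (2 : ℤ) ^ (n + 1) - (2 ^ (n + 2) - s) = s - 2 ^ (n + 1) := by omega
  rw [h3, h4, h6, h5, sub_zero, zero_add] at h1
  simp only [rsState, keepMap, rsCross_succ_of_pos (n + 1) h0,
    rsCross_succ_neg_of_pos (n + 1) h0, h1]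

theorem rsState_reflect (n : ℕ) {s : ℤ} (h0 : 0 < s) (hs : s ≤ 2 ^ n) :
    rsState (n + 2) (2 ^ (n + 1) - s) = reflectMap (rsState (n + 1) s) := by
  have hp : (2 : ℤ) ^ (n + 1) = 2 ^ n + 2 ^ n := by ring
  have hq : (2 : ℤ) ^ (n + 2) = 2 ^ (n + 1) + 2 ^ (n + 1) := by ring
  have h0' : 0 < (2 : ℤ) ^ (n + 1) - s := by omega
  have h1 := rsCross_succ_of_pos (n + 1) (s := 2 ^ (n + 1) + s) (by omega)
  have h3 := rsCross_eq_zero (n + 1) (s := 2 ^ (n + 1) + s) (by omega)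
  have h4 := rsCross_eq_zero (n + 1) (s := -(2 ^ (n + 1) + s)) (by omega)
  have h5 := rsCross_sub_two_pow n h0 hs
  have h6 : (2 : ℤ) ^ (n + 1) - (2 ^ (n + 1) + s) = -s := by omega
  have h7 : (2 : ℤ) ^ (n + 2) - (2 ^ (n + 1) - s) = 2 ^ (n + 1) + s := by omega
  rw [h3, h4, h6, sub_zero, zero_add] at h1
  have h8 := rsCross_succ_neg_of_pos (n + 1) h0'
  rw [neg_sub, h5, sub_sub_cancel] at h8
  simp only [rsState, reflectMap, h7, h1, rsCross_succ_of_pos (n + 1) h0', neg_sub, h5,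
    sub_sub_cancel, h8, Prod.mk.injEq, and_true]
  constructor <;> ring

/-- A list containing every `rsState (n + 1) s` with `0 < s ≤ 2 ^ n`. -/
def rsOrbit : ℕ → List (ℤ × ℤ × ℤ)
  | 0 => [(0, 0, 0), (1, -1, 1)]
  | n + 1 => (rsOrbit n).flatMap fun v => [keepMap v, reflectMap v]

theorem keepMap_mem_rsOrbit {n : ℕ} {v : ℤ × ℤ × ℤ} (h : v ∈ rsOrbit n) :
    keepMap v ∈ rsOrbit (n + 1) := List.mem_flatMap.2 ⟨v, h, by simp⟩

theorem reflectMap_mem_rsOrbit {n : ℕ} {v : ℤ × ℤ × ℤ} (h : v ∈ rsOrbit n) :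
    reflectMap v ∈ rsOrbit (n + 1) := List.mem_flatMap.2 ⟨v, h, by simp⟩

theorem zero_mem_rsOrbit (n : ℕ) : (0, 0, 0) ∈ rsOrbit n := by
  induction n with
  | zero => simp [rsOrbit]
  | succ n ih => simpa [keepMap] using keepMap_mem_rsOrbit ih

theorem rsState_one : rsState 1 1 = (1, -1, 1) := by
  simp [rsState, rsCross, rsCorr]

theorem rsState_mem_rsOrbit (n : ℕ) {s : ℤ} (h0 : 0 < s) (hs : s ≤ 2 ^ n) :
    rsState (n + 1) s ∈ rsOrbit n := by
  induction n generalizing s with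
  | zero =>
    obtain rfl : s = 1 := by omega
    simp [rsState_one, rsOrbit]
  | succ n ih =>
    have hp : (2 : ℤ) ^ (n + 1) = 2 ^ n + 2 ^ n := by ring
    rcases le_or_gt s (2 ^ n) with h | h
    · rw [rsState_keep n h0 h]
      exact keepMap_mem_rsOrbit (ih h0 h)
    -- The midpoint `s = 2 ^ (n + 1)` is no reflection of an admissible shift; its state is zero,
    -- hence the seed `(0, 0, 0)` in `rsOrbit`.
    · rcases hs.eq_or_lt with rfl | h'
      · have h1 : (2 : ℤ) ^ (n + 2) - 2 ^ (n + 1) = 2 ^ (n + 1) := by ring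
        have h2 : rsCross (n + 2) (2 ^ (n + 1)) = 0 := by
          rw [rsCross_succ_of_pos (n + 1) h0, rsCross_eq_zero _ (by omega),
            rsCross_eq_zero _ (by omega), sub_self, sub_self, rsCross_zero_right, add_zero]
        have h3 : rsCross (n + 2) (-2 ^ (n + 1)) = 0 := by
          rw [rsCross_succ_neg_of_pos (n + 1) h0, rsCross_eq_zero _ (by omega),
            rsCross_eq_zero _ (by omega), sub_self, sub_self, rsCross_zero_right, sub_zero]
        rw [rsState, h1, h2, h3]
        exact zero_mem_rsOrbit _
      · have := rsState_reflect n (s := 2 ^ (n + 1) - s) (by omega) (by omega)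
        rw [sub_sub_cancel] at this
        rw [this]
        exact reflectMap_mem_rsOrbit (ih (by omega) (by omega))

/-- A general set `S` serves both the weak bounds (`Set.Iic`) and the strict ones (`Set.Iio`). -/
theorem abs_rsCross_mem (n : ℕ) (s : ℤ) {S : Set ℝ}
    (hM : ∀ v ∈ rsOrbit n, |(v.1 : ℝ)| ∈ S ∧ |(v.2.1 : ℝ)| ∈ S ∧ |(v.2.2 : ℝ)| ∈ S) :
    |(rsCross (n + 1) s : ℝ)| ∈ S := by
  have hM0 : |((0 : ℤ) : ℝ)| ∈ S := (hM _ (zero_mem_rsOrbit n)).1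
  have hp : (2 : ℤ) ^ (n + 1) = 2 ^ n + 2 ^ n := by ring
  have key {t : ℤ} (h0 : 0 < t) (ht : t ≤ 2 ^ n) := hM _ (rsState_mem_rsOrbit n h0 ht)
  by_cases h1 : 2 ^ (n + 1) ≤ s ∨ s ≤ -2 ^ (n + 1)
  · rwa [rsCross_eq_zero _ h1]
  rcases lt_trichotomy s 0 with h | rfl | h
  · rcases le_or_gt (-2 ^ n) s with h2 | h2
    · simpa [rsState] using (key (t := -s) (by omega) (by omega)).2.1
    · have h3 := rsCross_sub_two_pow n (s := s + 2 ^ (n + 1)) (by omega) (by omega)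
      rw [add_sub_cancel_right] at h3
      rw [h3, Int.cast_neg, abs_neg]
      exact (key (t := s + 2 ^ (n + 1)) (by omega) (by omega)).2.2
  · rwa [rsCross_zero_right]
  · rcases le_or_gt s (2 ^ n) with h2 | h2
    · exact (key h h2).1
    · simpa [rsState] using (key (t := 2 ^ (n + 1) - s) (by omega) (by omega)).2.2

/-! ### From crosscorrelations to peak sidelobe levels. -/

theorem norm_crossCorr_rsSeq (n : ℕ) {s : ℤ} (hs : s ≠ 0) :
    ‖crossCorr (rsSeq (n + 1)) (rsSeq (n + 1)) s‖ = |(rsCross n (2 ^ n - |s|) : ℝ)| := by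
  rw [(crossCorr_rs _ _).1, Complex.norm_intCast]
  rcases hs.lt_or_gt with h | h
  · rw [← rsCorr_auto_neg _ hs, rsCorr_auto_succ_of_pos n (by omega), abs_of_neg h]
  · rw [rsCorr_auto_succ_of_pos n h, abs_of_pos h]

theorem PSL_rsSeq_zero : PSL (rsSeq 0) = 0 := by
  obtain ⟨s, hs, h⟩ := (isGreatest_PSL (rsSeq 0)).1
  rw [h, (crossCorr_rs _ _).1]
  simp [rsCorr, hs]

theorem PSL_rsSeq_one : PSL (rsSeq 1) = 1 := by
  refine le_antisymm ?_ ?_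
  · obtain ⟨s, hs, h⟩ := (isGreatest_PSL (rsSeq 1)).1
    rw [h, norm_crossCorr_rsSeq 0 hs]
    simp only [rsCross, rsCorr]
    split_ifs <;> simp
  · refine (isGreatest_PSL (rsSeq 1)).2 ⟨1, one_ne_zero, ?_⟩
    rw [norm_crossCorr_rsSeq 0 one_ne_zero]
    simp [rsCross, rsCorr]

theorem PSL_rsSeq_mem (n : ℕ) {S : Set ℝ}
    (hM : ∀ v ∈ rsOrbit n, |(v.1 : ℝ)| ∈ S ∧ |(v.2.1 : ℝ)| ∈ S ∧ |(v.2.2 : ℝ)| ∈ S) :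
    PSL (rsSeq (n + 2)) ∈ S := by
  obtain ⟨s, hs, h⟩ := (isGreatest_PSL (rsSeq (n + 2))).1
  rw [h, norm_crossCorr_rsSeq (n + 1) hs]
  exact abs_rsCross_mem n _ hM

theorem abs_rsCross_le_PSL (n : ℕ) {t : ℤ} (ht : t < 2 ^ n) :
    |(rsCross n t : ℝ)| ≤ PSL (rsSeq (n + 1)) := by
  refine (isGreatest_PSL (rsSeq (n + 1))).2 ⟨2 ^ n - t, by omega, ?_⟩
  rw [norm_crossCorr_rsSeq n (by omega), abs_of_pos (show 0 < 2 ^ n - t by omega),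
    sub_sub_cancel]

theorem PSL_rsSeq_eq_PSL_rsCompanion (n : ℕ) : PSL (rsSeq n) = PSL (rsCompanion n) := by
  unfold PSL
  congr 1
  ext r
  refine exists_congr fun s => and_congr_right fun hs => ?_
  rw [(crossCorr_rs n s).1, (crossCorr_rs n s).2.1, rsCorr_complementary n hs, Int.cast_neg,
    norm_neg]

/-! ### Lower bound along the orbit of `reflectMap`. -/

theorem exists_rsState_eq_iterate_reflectMap (n : ℕ) :
    ∃ s : ℤ, 0 < s ∧ s ≤ 2 ^ n ∧ rsState (n + 1) s = reflectMap^[n] (1, -1, 1) := by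
  induction n with
  | zero => exact ⟨1, by norm_num, by norm_num, rsState_one⟩
  | succ n ih =>
    obtain ⟨s, h0, h1, h⟩ := ih
    have hp : (2 : ℤ) ^ (n + 1) = 2 ^ n + 2 ^ n := by ring
    refine ⟨2 ^ (n + 1) - s, by omega, by omega, ?_⟩
    rw [rsState_reflect n h0 h1, h, Function.iterate_succ_apply']

/-- Up to sign, the crosscorrelation values found along the orbit of `reflectMap`. -/
def rsPeak : ℕ → ℤ
  | 0 => 0
  | 1 => 1
  | 2 => 1
  | n + 3 => -rsPeak (n + 2) + 2 * rsPeak (n + 1) + 4 * rsPeak n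

theorem iterate_reflectMap (n : ℕ) :
    reflectMap^[n] (1, -1, 1) = ((-1) ^ n * (2 * rsPeak (n + 1) - rsPeak (n + 3)),
      (-1) ^ (n + 1) * rsPeak (n + 2), (-1) ^ n * rsPeak (n + 1)) := by
  induction n with
  | zero => simp [rsPeak]
  | succ n ih =>
    have h : rsPeak (n + 4) = -rsPeak (n + 3) + 2 * rsPeak (n + 2) + 4 * rsPeak (n + 1) := rfl
    rw [Function.iterate_succ_apply', ih]
    simp only [reflectMap, show n + 1 + 3 = n + 4 from rfl, show n + 1 + 2 = n + 3 from rfl,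
      show n + 1 + 1 = n + 2 from rfl, h,
      pow_succ, Prod.mk.injEq]
    refine ⟨by ring, by ring, trivial⟩

theorem abs_rsPeak_le_PSL (n : ℕ) : |(rsPeak n : ℝ)| ≤ PSL (rsSeq n) := by
  match n with
  | 0 => simp [rsPeak, PSL_rsSeq_zero]
  | 1 => simp [rsPeak, PSL_rsSeq_one]
  | n + 2 =>
    obtain ⟨s, h0, h1, h⟩ := exists_rsState_eq_iterate_reflectMap n
    have hp : (0 : ℤ) < 2 ^ (n + 1) := by positivity
    have h2 := abs_rsCross_le_PSL (n + 1) (t := -s) (by omega)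
    rw [iterate_reflectMap, rsState, Prod.mk.injEq, Prod.mk.injEq] at h
    rw [h.2.1] at h2
    simpa [abs_mul] using h2

theorem rsPeak_cubic {a : ℝ} (ha : a ^ 3 + a ^ 2 - 2 * a - 4 = 0) (h1 : 1.658967 ≤ a)
    (h2 : a ≤ 1.658968) (n : ℕ) :
    ((3 * a ^ 2 + 21 * a + 2) / 118
        - √((6 * a ^ 2 + 6 * a - 16) / 59) * √((a ^ 2 - 1) / 2) ^ n) * a ^ n ≤ rsPeak n := by
  set c := (3 * a ^ 2 + 21 * a + 2) / 118 with hc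
  set d := √((6 * a ^ 2 + 6 * a - 16) / 59) with hd
  set N := a ^ 2 + a - 2 with hN
  set w : ℕ → ℝ := fun n => rsPeak n - c * a ^ n with hw
  -- The cubic factors as `(X - a) * (X ^ 2 + (1 + a) * X + N)`; `c` is the coefficient of `a ^ n`
  -- in the closed form, so the remainder `w` obeys the quadratic factor.
  have hrec (n : ℕ) : w (n + 2) = -(1 + a) * w (n + 1) - N * w n := by
    induction n with
    | zero =>
      simp only [hw, rsPeak, hc, hN]
      push_cast
      linear_combination -(9 * a + 60) / 118 * ha
    | succ n ih =>
      have e : w (n + 3) = -w (n + 2) + 2 * w (n + 1) + 4 * w n := by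
        simp only [hw, rsPeak]
        push_cast
        linear_combination -c * a ^ n * ha
      rw [show n + 1 + 2 = n + 3 from rfl, e, show n + 1 + 1 = n + 2 from rfl]
      linear_combination a * ih - w n * ha
  -- Each step multiplies this quadratic form by `N`. It is positive definite by `hpos`, so
  -- completing the square bounds `w n`.
  have hinv (n : ℕ) : w (n + 1) ^ 2 + (1 + a) * w (n + 1) * w n + N * w n ^ 2
      = d ^ 2 * (N - (1 + a) ^ 2 / 4) * N ^ n := by
    induction n with
    | zero =>
      rw [hd, Real.sq_sqrt (by nlinarith)]
      simp only [hw, rsPeak, hc, hN]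
      push_cast
      linear_combination (27 * a ^ 3 + 369 * a ^ 2 + 216 * a - 1296) / 13924 * ha
    | succ n ih =>
      rw [show n + 1 + 1 = n + 2 from rfl, hrec]
      linear_combination N * ih
  have hpos : 0 < N - (1 + a) ^ 2 / 4 := by nlinarith
  have ha0 : 0 ≤ a := by linarith
  have hle : w n ^ 2 ≤ (d * (√((a ^ 2 - 1) / 2) ^ n * a ^ n)) ^ 2 := by
    have e : (d * (√((a ^ 2 - 1) / 2) ^ n * a ^ n)) ^ 2 = d ^ 2 * N ^ n := by
      rw [mul_pow d, ← mul_pow √_ a, ← pow_mul, mul_comm n 2, pow_mul, mul_pow √_ a,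
        Real.sq_sqrt (show 0 ≤ (a ^ 2 - 1) / 2 by nlinarith)]
      congr 2
      linear_combination (a / 2 - 1 / 2) * ha
    rw [e]
    refine le_of_mul_le_mul_left ?_ hpos
    have := hinv n
    nlinarith [sq_nonneg (w (n + 1) + (1 + a) / 2 * w n)]
  have := (abs_le_of_sq_le_sq' hle (by positivity)).1
  simp only [hw] at this
  linarith

/-! ### Upper bound: the polytope norm. -/

/-- The left eigenvector of `reflectMap` for the eigenvalue `-a`, where `a` is the real root of
`X ^ 3 + X ^ 2 - 2 * X - 4`. -/
def reflectEigen (a p q r : ℝ) : ℝ := p + (1 + a) * q - (a + a ^ 2) * r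

/-- The ball of radius `c` of a polytope norm which `keepMap` and `reflectMap` expand at most by
the factor `a`. -/
structure InPolytope (a c p q r : ℝ) : Prop where
  eigen : |14 * reflectEigen a p q r| ≤ 50 * c
  facet₁ : |51 * q + 4 * r| ≤ 50 * c
  facet₂ : |52 * p + 6 * q + 5 * r| ≤ 50 * c
  facet₃ : |45 * p - 41 * q + 10 * r| ≤ 50 * c
  facet₄ : |-33 * p + 8 * q + 62 * r| ≤ 50 * c
  facet₅ : |28 * p + 2 * q + 72 * r| ≤ 50 * c
  facet₆ : |17 * p + 44 * q + 36 * r| ≤ 50 * c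
  facet₇ : |39 * p - 37 * q - 38 * r| ≤ 50 * c
  facet₈ : |-17 * p + 22 * q + 74 * r| ≤ 50 * c

/-- Rounding `a` to `1.658967` and `a + a ^ 2` to `4.411139` makes the irrational facet rational, so
`linarith` can use it. -/
theorem abs_reflectEigen_sub_le {a c p q r : ℝ} (h1 : 1.65896708 ≤ a) (h2 : a ≤ 1.65896709)
    (hq : |q| ≤ 3 * c) (hr : |r| ≤ 3 * c) :
    |14 * reflectEigen a p q r - (14 * p + 37.225538 * q - 61.755946 * r)| ≤ 1e-4 * c := by
  have e : 14 * reflectEigen a p q r - (14 * p + 37.225538 * q - 61.755946 * r)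
      = 14 * (a - 1.658967) * q - 14 * (a + a ^ 2 - 4.411139) * r := by
    unfold reflectEigen; ring
  rw [e]
  refine (abs_sub _ _).trans ?_
  rw [abs_mul _ q, abs_mul _ r]
  have b1 : |14 * (a - 1.658967)| ≤ 1e-5 := by rw [abs_le]; constructor <;> linarith
  have b2 : |14 * (a + a ^ 2 - 4.411139)| ≤ 1e-5 := by rw [abs_le]; constructor <;> nlinarith
  have := mul_le_mul b1 hq (abs_nonneg _) (by norm_num)
  have := mul_le_mul b2 hr (abs_nonneg _) (by norm_num)
  have := (abs_nonneg q).trans hq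
  linarith

namespace InPolytope

variable {a c p q r : ℝ}

theorem approx (h : InPolytope a c p q r) (h1 : 1.65896708 ≤ a) (h2 : a ≤ 1.65896709) :
    |14 * reflectEigen a p q r - (14 * p + 37.225538 * q - 61.755946 * r)| ≤ 1e-4 * c := by
  have hqr : |q| ≤ 3 * c ∧ |r| ≤ 3 * c := by
    obtain ⟨-, h1, h2, h3, h4, h5, h6, h7, h8⟩ := h
    simp only [abs_le] at *
    refine ⟨⟨?_, ?_⟩, ?_, ?_⟩ <;> linarith
  exact abs_reflectEigen_sub_le h1 h2 hqr.1 hqr.2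

theorem abs_lt (h : InPolytope a c p q r) (hc : 0 < c) (h1 : 1.65896708 ≤ a)
    (h2 : a ≤ 1.65896709) : |p| < c ∧ |q| < c ∧ |r| < c := by
  have e := h.approx h1 h2
  obtain ⟨h0, h1, h2, h3, h4, h5, h6, h7, h8⟩ := h
  simp only [abs_le, _root_.abs_lt] at *
  refine ⟨⟨?_, ?_⟩, ⟨?_, ?_⟩, ?_, ?_⟩ <;> linarith

theorem keep (h : InPolytope a c p q r) (hc : 0 < c) (h1 : 1.65896708 ≤ a)
    (h2 : a ≤ 1.65896709) : InPolytope a (a * c) (p - q + r) (p - q - r) (-r) := by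
  obtain ⟨hp, hq, hr⟩ := h.abs_lt hc h1 h2
  have e1 := h.approx h1 h2
  have e2 := abs_reflectEigen_sub_le (c := c) (p := p - q + r) (q := p - q - r) (r := -r) h1 h2
    (by rw [_root_.abs_lt] at *; rw [abs_le]; constructor <;> linarith)
    (by rw [abs_neg]; linarith)
  have hac : 1.65896708 * c ≤ a * c := by gcongr
  obtain ⟨h0, h1, h2, h3, h4, h5, h6, h7, h8⟩ := h
  -- With `d` known only through `hac`, every goal is linear.
  generalize a * c = d at *
  constructor <;> simp only [abs_le] at * <;> constructor <;> linarith

theorem reflect (h : InPolytope a c p q r) (hc : 0 < c) (h1 : 1.65896708 ≤ a)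
    (h2 : a ≤ 1.65896709) (ha : a ^ 3 + a ^ 2 - 2 * a - 4 = 0) :
    InPolytope a (a * c) (p + 2 * r) (2 * r - p) q := by
  obtain ⟨hp, hq, hr⟩ := h.abs_lt hc h1 h2
  have e1 := h.approx h1 h2
  have hac : 1.65896708 * c ≤ a * c := by gcongr
  have ha0 : 0 ≤ a := by linarith
  -- The eigenvector facet is scaled by exactly `a`, leaving no room for rounding, so it is treated
  -- exactly.
  have e2 : 14 * reflectEigen a (p + 2 * r) (2 * r - p) q = -(a * (14 * reflectEigen a p q r)) := by
    unfold reflectEigen; linear_combination -14 * r * ha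
  have e3 : |14 * reflectEigen a (p + 2 * r) (2 * r - p) q| ≤ 50 * (a * c) := by
    rw [e2, abs_neg, abs_mul, abs_of_nonneg ha0]
    have := mul_le_mul_of_nonneg_left h.eigen ha0
    linarith
  obtain ⟨h0, h1, h2, h3, h4, h5, h6, h7, h8⟩ := h
  refine ⟨e3, ?_, ?_, ?_, ?_, ?_, ?_, ?_, ?_⟩ <;> clear e3 e2 <;> generalize a * c = d at * <;>
    simp only [abs_le] at * <;> constructor <;> linarith

end InPolytope

theorem rsOrbit_six_bound : ∀ v ∈ rsOrbit 6, |v.2.1| ≤ 40 ∧ |v.2.2| ≤ 40 ∧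
    |14000000 * v.1 + 37225538 * v.2.1 - 61755946 * v.2.2| ≤ 1893000000 ∧
    |51 * v.2.1 + 4 * v.2.2| ≤ 1893 ∧ |52 * v.1 + 6 * v.2.1 + 5 * v.2.2| ≤ 1893 ∧
    |45 * v.1 - 41 * v.2.1 + 10 * v.2.2| ≤ 1893 ∧ |-33 * v.1 + 8 * v.2.1 + 62 * v.2.2| ≤ 1893 ∧
    |28 * v.1 + 2 * v.2.1 + 72 * v.2.2| ≤ 1893 ∧ |17 * v.1 + 44 * v.2.1 + 36 * v.2.2| ≤ 1893 ∧
    |39 * v.1 - 37 * v.2.1 - 38 * v.2.2| ≤ 1893 ∧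
    |-17 * v.1 + 22 * v.2.1 + 74 * v.2.2| ≤ 1893 := by
  decide +kernel

theorem inPolytope_of_mem_rsOrbit {a : ℝ} (h1 : 1.65896708 ≤ a) (h2 : a ≤ 1.65896709)
    (ha : a ^ 3 + a ^ 2 - 2 * a - 4 = 0) (n : ℕ) :
    ∀ v ∈ rsOrbit (n + 6), InPolytope a (5 * a ^ (n + 4)) v.1 v.2.1 v.2.2 := by
  have ha0 : 0 < a := by linarith
  induction n with
  | zero =>
    intro v hv
    rw [zero_add]
    -- The integer check uses `1893`; the spare `0.5` absorbs the rounding error `1e-4 * 40`.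
    have h4 : 1893.5 ≤ 50 * (5 * a ^ 4) := by
      have : (1.65896708 : ℝ) ^ 4 ≤ a ^ 4 := by gcongr
      norm_num at this ⊢
      linarith
    obtain ⟨bq, br, b0, b1, b2, b3, b4, b5, b6, b7, b8⟩ := rsOrbit_six_bound v hv
    have cast {x M : ℤ} (h : |x| ≤ M) : |(x : ℝ)| ≤ M := by exact_mod_cast h
    have bq' := cast bq
    have br' := cast br
    have e1 := abs_reflectEigen_sub_le (c := 40) (p := v.1) h1 h2
      (bq'.trans (by norm_num)) (br'.trans (by norm_num))
    have b0' := cast b0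
    push_cast at b0'
    have up {x : ℤ} (h : |x| ≤ 1893) : |(x : ℝ)| ≤ 50 * (5 * a ^ 4) :=
      (cast h).trans ((by norm_num : ((1893 : ℤ) : ℝ) ≤ 1893.5).trans h4)
    refine ⟨?_, by simpa using up b1, by simpa using up b2, by simpa using up b3,
      by simpa using up b4, by simpa using up b5, by simpa using up b6, by simpa using up b7,
      by simpa using up b8⟩
    rw [abs_le] at *
    constructor <;> linarith
  | succ n ih =>
    intro v hv
    obtain ⟨u, hu, hv⟩ := List.mem_flatMap.1 hv
    have e : 5 * a ^ (n + 1 + 4) = a * (5 * a ^ (n + 4)) := by ring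
    have hc : 0 < 5 * a ^ (n + 4) := by positivity
    rw [e]
    simp only [List.mem_cons, List.not_mem_nil, or_false] at hv
    rcases hv with rfl | rfl
    · simpa [keepMap] using (ih u hu).keep hc h1 h2
    · simpa [reflectMap] using (ih u hu).reflect hc h1 h2 ha

/-! ### The real root, small cases and conclusion. -/

theorem exists_root_cubic : ∃ a : ℝ, 1.65896708 ≤ a ∧ a ≤ 1.65896709 ∧
    a ^ 3 + a ^ 2 - 2 * a - 4 = 0 := by
  have := intermediate_value_Icc (a := (1.65896708 : ℝ)) (b := 1.65896709) (by norm_num)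
    (f := fun a : ℝ => a ^ 3 + a ^ 2 - 2 * a - 4) (by fun_prop)
  obtain ⟨a, ⟨h1, h2⟩, ha⟩ := this (show (0 : ℝ) ∈ _ by norm_num)
  exact ⟨a, h1, h2, ha⟩

theorem eq_of_cubic_eq_zero {a t : ℝ} (h1 : 1.65896708 ≤ a)
    (ha : a ^ 3 + a ^ 2 - 2 * a - 4 = 0) (ht : t ^ 3 + t ^ 2 - 2 * t - 4 = 0) : t = a := by
  have h : (t - a) * (t ^ 2 + (1 + a) * t + a ^ 2 + a - 2) = 0 := by linear_combination ht - ha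
  rcases mul_eq_zero.1 h with h | h
  · linarith
  -- The quadratic cofactor has discriminant `9 - 2 * a - 3 * a ^ 2 < 0`.
  · nlinarith [sq_nonneg (t + (1 + a) / 2)]

theorem rsOrbit_small_bound (n : ℕ) (hn : n < 6) : ∀ v ∈ rsOrbit n,
    |v.1| ≤ [1, 3, 5, 7, 13, 19].getD n 0 ∧ |v.2.1| ≤ [1, 3, 5, 7, 13, 19].getD n 0 ∧
      |v.2.2| ≤ [1, 3, 5, 7, 13, 19].getD n 0 := by
  interval_cases n <;> decide +kernel

theorem PSL_rsSeq_le_of_lt_six {n : ℕ} (hn : n < 6) :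
    PSL (rsSeq (n + 2)) ≤ ([1, 3, 5, 7, 13, 19].getD n 0 : ℤ) := by
  refine PSL_rsSeq_mem n (S := Set.Iic _) fun v hv => ?_
  have := rsOrbit_small_bound n hn v hv
  simp only [Set.mem_Iic]
  exact_mod_cast this

theorem PSL_rsSeq_lt {a : ℝ} (h1 : 1.65896708 ≤ a) (h2 : a ≤ 1.65896709)
    (ha : a ^ 3 + a ^ 2 - 2 * a - 4 = 0) {n : ℕ} (hn : n ≠ 4) :
    PSL (rsSeq n) < 5 * a ^ ((n : ℤ) - 4) := by
  have ha0 : 0 < a := by linarith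
  rw [zpow_sub₀ ha0.ne', zpow_natCast, ← mul_div_assoc, lt_div_iff₀ (by positivity)]
  norm_cast
  have p4 : a ^ 4 ≤ 7.5745 := by
    have : a ^ 4 ≤ (1.65896709 : ℝ) ^ 4 := by gcongr
    norm_num at this ⊢
    linarith
  have hlow (k : ℕ) : (1.65896708 : ℝ) ^ k ≤ a ^ k := by gcongr
  have small (k : ℕ) (M : ℤ) (h : PSL (rsSeq k) ≤ M) (hM : M * 7.5745 < 5 * (1.65896708 : ℝ) ^ k)
      (h0 : (0 : ℝ) ≤ M) : PSL (rsSeq k) * a ^ 4 < 5 * a ^ k := by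
    have := mul_le_mul h p4 (by positivity) h0
    linarith [hlow k]
  rcases lt_or_ge n 8 with h | h
  · interval_cases n
    · exact small 0 0 (by simp [PSL_rsSeq_zero]) (by norm_num) (by norm_num)
    · exact small 1 1 (by simp [PSL_rsSeq_one]) (by norm_num) (by norm_num)
    · exact small 2 1 (PSL_rsSeq_le_of_lt_six (n := 0) (by norm_num)) (by norm_num) (by norm_num)
    · exact small 3 3 (PSL_rsSeq_le_of_lt_six (n := 1) (by norm_num)) (by norm_num) (by norm_num)
    · exact absurd rfl hn
    · exact small 5 7 (PSL_rsSeq_le_of_lt_six (n := 3) (by norm_num)) (by norm_num) (by norm_num)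
    · exact small 6 13 (PSL_rsSeq_le_of_lt_six (n := 4) (by norm_num)) (by norm_num) (by norm_num)
    · exact small 7 19 (PSL_rsSeq_le_of_lt_six (n := 5) (by norm_num)) (by norm_num) (by norm_num)
  · obtain ⟨k, rfl⟩ := Nat.exists_eq_add_of_le' h
    have hc : 0 < 5 * a ^ (k + 4) := by positivity
    have h := PSL_rsSeq_mem (k + 6) (S := Set.Iio _) fun v hv =>
      (inPolytope_of_mem_rsOrbit h1 h2 ha k v hv).abs_lt hc h1 h2
    calc PSL (rsSeq (k + 8)) * a ^ 4 < 5 * a ^ (k + 4) * a ^ 4 := by gcongr; exact h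
      _ = 5 * a ^ (k + 8) := by ring

theorem PSL_rsSeq_four : PSL (rsSeq 4) = 5 := by
  refine le_antisymm ((PSL_rsSeq_le_of_lt_six (n := 2) (by norm_num)).trans (by norm_num)) ?_
  simpa [rsPeak] using abs_rsPeak_le_PSL 4

theorem theorem1p2 :
    ∃ α₀ : ℝ,
      -- `α₀` is the unique real root of the polynomial
      (∀ t : ℝ, (X ^ 3 + X ^ 2 - 2 * X - 4 : ℝ[X]).IsRoot t ↔ t = α₀) ∧
      -- decimal expansions (to six places) of the constants
      α₀ ∈ Set.Ico 1.658967 1.658968 ∧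
      5 * α₀ ^ (-4 : ℤ) ∈ Set.Ico (0.660113 : ℝ) 0.660114 ∧
      (3 * α₀ ^ 2 + 21 * α₀ + 2) / 118 ∈ Set.Ico (0.382159 : ℝ) 0.382160 ∧
      √((6 * α₀ ^ 2 + 6 * α₀ - 16) / 59) ∈ Set.Ico (0.421193 : ℝ) 0.421194 ∧
      √((α₀ ^ 2 - 1) / 2) ∈ Set.Ico (0.935994 : ℝ) 0.935995 ∧
      ∀ n : ℕ,
        PSL (rsSeq n) = PSL (rsCompanion n) ∧
        PSL (rsSeq n) ≤ 5 * α₀ ^ ((n : ℤ) - 4) ∧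
        (PSL (rsSeq n) = 5 * α₀ ^ ((n : ℤ) - 4) ↔ n = 4) ∧
        ((3 * α₀ ^ 2 + 21 * α₀ + 2) / 118
            - √((6 * α₀ ^ 2 + 6 * α₀ - 16) / 59) * √((α₀ ^ 2 - 1) / 2) ^ n) * α₀ ^ n
          ≤ PSL (rsSeq n) := by
  obtain ⟨a, h1, h2, ha⟩ := exists_root_cubic
  have ha0 : 0 < a := by linarith
  have hsq1 : 2.75217177 ≤ a ^ 2 := by nlinarith
  have hsq2 : a ^ 2 ≤ 2.75217181 := by nlinarith
  have hfour : 5 * a ^ (((4 : ℕ) : ℤ) - 4) = 5 := by norm_num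
  refine ⟨a, fun t => ?_, ⟨by linarith, by linarith⟩, ?_, ⟨by linarith, by linarith⟩,
    ⟨Real.le_sqrt_of_sq_le (by linarith), (Real.sqrt_lt' (by norm_num)).2 (by linarith)⟩,
    ⟨Real.le_sqrt_of_sq_le (by linarith), (Real.sqrt_lt' (by norm_num)).2 (by linarith)⟩,
    fun n => ⟨PSL_rsSeq_eq_PSL_rsCompanion n, ?_, ?_, ?_⟩⟩
  · simp only [IsRoot.def, eval_sub, eval_add, eval_pow, eval_X, eval_mul, eval_ofNat]
    exact ⟨fun ht => eq_of_cubic_eq_zero h1 ha ht, fun ht => by rw [ht, ha]⟩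
  · have e : 5 * a ^ (-4 : ℤ) = 5 / a ^ 4 := by
      rw [zpow_neg, div_eq_mul_inv]
      norm_cast
    have h4 : a ^ 4 = (a ^ 2) ^ 2 := by ring
    rw [e, h4]
    exact ⟨(le_div_iff₀ (by positivity)).2 (by nlinarith),
      (div_lt_iff₀ (by positivity)).2 (by nlinarith)⟩
  · rcases eq_or_ne n 4 with rfl | hn
    · rw [PSL_rsSeq_four, hfour]
    · exact (PSL_rsSeq_lt h1 h2 ha hn).le
  · refine ⟨fun h => ?_, ?_⟩
    · by_contra hn
      exact (PSL_rsSeq_lt h1 h2 ha hn).ne h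
    · rintro rfl
      rw [PSL_rsSeq_four, hfour]
  · exact (rsPeak_cubic ha (by linarith) (by linarith) n).trans
      ((le_abs_self _).trans (abs_rsPeak_le_PSL n))
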